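/- Let $A$ be a finite set and let $k$ be a field. Let $F(A)$ be the free left regular band with identity on $A$: its elements are the words on $A$ without repeated letters (including the empty word), and the product of two words is their concatenation with every letter deleted that has occurred earlier. For $s\in F(A)$ let $\operatorname{supp}(s)\subseteq A$ be the set of letters of $s$. Let $kF(A)$ be the semigroup algebra. Recall that if $R$ is a finite-dimensional $k$-algebra whose simple left modules are all one-dimensional over $k$, then the quiver (Ext-quiver) of $R$ is the directed graph with one vertex for each isomorphism class of simple left $R$-modules and with $\dim_k \operatorname{Ext}^1_R(M,N)$ arrows from the vertex of $M$ to the vertex of $N$. **Theorem (K. S. Brown).** The algebra $kF(A)$ is finite-dimensional and its simple modules are all one-dimensional. The vertices of its quiver correspond bijectively to the subsets $X$ of $A$, the vertex $X$ being the class of the simple module on which each $s\in F(A)$ acts as $1$ if $\operatorname{supp}(s)\subseteq X$ and as $0$ otherwise. For subsets $X,Y\subseteq A$ there are exactly $\#(X\setminus Y)-1$ arrows from $X$ to $Y$ if $Y\subsetneq X$, and there are no arrows from $X$ to $Y$ otherwise. -/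

import Mathlib

universe u v w

/-! ### The free left regular band with identity -/

/-- The underlying set of the free left regular band with identity on `A`: words on the alphabet
`A` without repeated letters. -/
def FreeLRB (A : Type*) : Type _ := {l : List A // l.Nodup}

namespace FreeLRB

variable {A : Type*} [DecidableEq A]

/-- The product of two words without repeated letters: concatenate them, then delete every letter
that has occurred earlier. As neither word repeats a letter, the letters to delete are precisely
the letters of the second word that occur in the first. -/
def mul (x y : FreeLRB A) : FreeLRB A :=
  ⟨x.1 ++ y.1.filter (fun a => a ∉ x.1), by
    refine List.Nodup.append x.2 (y.2.filter _) ?_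
    intro a ha hb
    simp [ha] at hb⟩

instance : Monoid (FreeLRB A) where
  mul := mul
  one := ⟨[], List.nodup_nil⟩
  one_mul x := by
    apply Subtype.ext
    change [] ++ x.1.filter (fun a => a ∉ ([] : List A)) = x.1
    simp
  mul_one x := by
    apply Subtype.ext
    change x.1 ++ ([] : List A).filter (fun a => a ∉ x.1) = x.1
    simp
  mul_assoc x y z := by
    apply Subtype.ext
    change (x.1 ++ y.1.filter (fun a => a ∉ x.1)) ++
        z.1.filter (fun a => a ∉ x.1 ++ y.1.filter (fun a => a ∉ x.1)) =
      x.1 ++ (y.1 ++ z.1.filter (fun a => a ∉ y.1)).filter (fun a => a ∉ x.1)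
    rw [List.filter_append, List.filter_filter, List.append_assoc]
    congr 2
    apply List.filter_congr
    intro a _
    by_cases h1 : a ∈ x.1 <;> by_cases h2 : a ∈ y.1 <;> simp [h1, h2]

/-- The support of a word: the set of letters that occur in it. -/
def supp (x : FreeLRB A) : Finset A := x.1.toFinset

end FreeLRB

/-! ### The quiver of an algebra -/

section ExtQuiver

open CategoryTheory

/-- The simple left modules over a ring `R`, as objects of the category of `R`-modules. -/
def SimpleMod (R : Type v) [Ring R] : Type (v + 1) :=
  {M : ModuleCat.{v} R // IsSimpleModule R M}

/-- Isomorphism of simple modules. -/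
instance SimpleMod.setoid (R : Type v) [Ring R] : Setoid (SimpleMod R) where
  r M N := Nonempty (M.1 ≅ N.1)
  iseqv :=
    { refl := fun M => ⟨Iso.refl M.1⟩
      symm := fun ⟨e⟩ => ⟨e.symm⟩
      trans := fun ⟨e⟩ ⟨f⟩ => ⟨e.trans f⟩ }

/-- The vertices of the quiver of the `k`-algebra `R`: the isomorphism classes of simple left
`R`-modules. -/
def ExtQuiver (k : Type u) (R : Type v) [Field k] [Ring R] [Algebra k R] : Type (v + 1) :=
  Quotient (SimpleMod.setoid R)

namespace ExtQuiver

variable (k : Type u) {R : Type v} [Field k] [Ring R] [Algebra k R]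

/-- The vertex given by a simple module. -/
def mk (M : ModuleCat.{v} R) (hM : IsSimpleModule R M) : ExtQuiver k R :=
  Quotient.mk (SimpleMod.setoid R) ⟨M, hM⟩

/-- A simple module in the isomorphism class `x`. -/
noncomputable def repr {k : Type u} [Field k] [Algebra k R] (x : ExtQuiver k R) : ModuleCat.{v} R :=
  (Quotient.out x : SimpleMod R).1

/-- The quiver of the `k`-algebra `R`: there are `dim_k Ext¹_R(M_x, M_y)` arrows from `x` to `y`,
the set of arrows being the index set of a `k`-basis of that space. -/
noncomputable instance : Quiver.{v} (ExtQuiver k R) where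
  Hom x y := Module.Basis.ofVectorSpaceIndex k (Abelian.Ext.{v} x.repr y.repr 1)

end ExtQuiver

end ExtQuiver

/-! Write `R` for the algebra and `χ_X` for the 0/1 character of `X`. If a word `s` of maximal
support acts nontrivially on a simple module, then `s * t = s` for `t.supp ⊆ s.supp`, while `s * t`
acts as zero for all other `t`. So the kernel of `s` is a submodule, hence zero, and cancelling `s`
shows that the action is through `χ_X` with `X = s.supp` (`exists_char_of_isSimpleModule`).

Let `M`, `N` be simple with characters `χ_X`, `χ_Y`. As `M` is `R` modulo the kernel `I` of `χ_X`,
`Ext¹(M, N)` is `Hom(I, N)` modulo restrictions from `R`. A map on `I` is the same as a crossed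
homomorphism, by `g s = f (s - χ_X(s))`, and restrictions become principal ones
(`exists_linearMap_crossedHom_ext`). Unless `Y ⊂ X`, every crossed homomorphism is principal. If `Y
⊂ X`, crossed homomorphisms are given by arbitrary values on the letters of `X \ Y`, and the
principal ones form a line, which accounts for the `- 1`. -/

/-! ### Ext¹ of a cyclic module -/

open CategoryTheory in
open scoped ModuleCat in
/-- If `M` is generated by `m`, then `Ext¹(M, N)` is the space of linear maps from the annihilator
of `m` to `N`, modulo the restrictions of the maps `r ↦ r • n`. -/
theorem exists_linearMap_annihilator_ext (k : Type u) {R : Type v} [Field k] [Ring R] [Algebra k R]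
    (M N : ModuleCat.{v} R) (m : M)
    (hgen : Function.Surjective (LinearMap.toSpanSingleton R M m)) :
    ∃ Φ : (ModuleCat.of R (LinearMap.toSpanSingleton R M m).ker ⟶ N) →ₗ[k] Abelian.Ext.{v} M N 1,
      Function.Surjective Φ ∧
      ∀ f, Φ f = 0 ↔ ∃ n : N, ∀ x : (LinearMap.toSpanSingleton R M m).ker, f.hom x = x.1 • n := by
  have hS := LinearMap.shortExact_shortComplexKer hgen
  have hproj : Projective (LinearMap.toSpanSingleton R M m).shortComplexKer.X₂ :=
    inferInstanceAs (Projective (ModuleCat.of R R))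
  refine ⟨(Abelian.Ext.precompOfLinear hS.extClass k N (add_zero 1)).comp
    (Abelian.Ext.linearEquiv₀ (R := k)).symm.toLinearMap, ?_, ?_⟩
  -- The class pulled back to the projective module `R` vanishes, so it comes from the connecting
  -- map.
  · intro x
    obtain ⟨y, hy⟩ := Abelian.Ext.contravariant_sequence_exact₃ hS N x
      (Abelian.Ext.eq_zero_of_projective _) (add_zero 1)
    refine ⟨Abelian.Ext.linearEquiv₀ (R := k) y, ?_⟩
    simpa using hy
  · intro f
    constructor
    · intro hf
      obtain ⟨y, hy⟩ := Abelian.Ext.contravariant_sequence_exact₁ hS N (Abelian.Ext.mk₀ f)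
        (add_zero 1) (by simpa using hf)
      obtain ⟨g, rfl⟩ := (Abelian.Ext.linearEquiv₀ (R := k)).symm.surjective y
      have hy' : (LinearMap.toSpanSingleton R M m).shortComplexKer.f ≫ g = f :=
        (Abelian.Ext.mk₀_bijective _ _).1 (by simpa using hy)
      -- `f` extends to `g : R → N`, and such a map is determined by its value at `1`.
      refine ⟨g.hom (1 : R), fun x => ?_⟩
      rw [← hy', ← map_smul]
      simp
    · rintro ⟨n, hn⟩
      have hf : f = (LinearMap.toSpanSingleton R M m).shortComplexKer.f ≫
          ModuleCat.ofHom (LinearMap.toSpanSingleton R N n) := by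
        ext x
        simpa using hn x
      rw [hf]
      simp [← Abelian.Ext.mk₀_comp_mk₀, hS.extClass_comp_assoc]

/-! ### Crossed homomorphisms and Ext¹ -/

section CrossedHom

variable {k S : Type*} [Field k] [Monoid S] (χ : S →* k) (N : Type*) [AddCommGroup N] [Module k N]
  [Module (MonoidAlgebra k S) N] [IsScalarTower k (MonoidAlgebra k S) N]

/-- The maps `g : S → N` such that `g (s * t) = s • g t + χ t • g s`. -/
def crossedHom : Submodule k (S → N) where
  carrier := {g | ∀ s t, g (s * t) = MonoidAlgebra.of k S s • g t + χ t • g s}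
  add_mem' {f g} hf hg s t := by
    simp only [Set.mem_ofPred_eq] at hf hg
    simp only [Pi.add_apply, hf, hg, smul_add]
    abel
  zero_mem' s t := by simp
  smul_mem' c g hg s t := by
    simp only [Set.mem_ofPred_eq] at hg
    simp only [Pi.smul_apply, hg, smul_add]
    rw [smul_comm c (χ t), smul_comm c (MonoidAlgebra.of k S s)]

variable {χ N}

theorem crossedHom.apply_mul {g : S → N} (hg : g ∈ crossedHom χ N) (s t : S) :
    g (s * t) = MonoidAlgebra.of k S s • g t + χ t • g s := hg s t

/-- The linear extension of a map on the monoid to the monoid algebra. -/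
noncomputable def MonoidAlgebra.linearExtend (k : Type*) {S N : Type*} [Field k] [AddCommGroup N]
    [Module k N] : (S → N) →ₗ[k] MonoidAlgebra k S →ₗ[k] N where
  toFun g := (Finsupp.linearCombination k g).comp (MonoidAlgebra.coeffLinearEquiv k).toLinearMap
  map_add' f g := by ext; simp
  map_smul' c f := by ext; simp

omit [Module (MonoidAlgebra k S) N] [IsScalarTower k (MonoidAlgebra k S) N] in
@[simp]
theorem MonoidAlgebra.linearExtend_of (g : S → N) (s : S) :
    MonoidAlgebra.linearExtend k g (MonoidAlgebra.of k S s) = g s := by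
  simp [MonoidAlgebra.linearExtend]

/-- Both sides are bilinear in `r` and `x`. When `χ` kills `x` the last term drops out, so the
extension is `R`-linear on the kernel of `χ`. -/
theorem crossedHom.linearExtend_mul {g : S → N} (hg : g ∈ crossedHom χ N)
    (r x : MonoidAlgebra k S) :
    MonoidAlgebra.linearExtend k g (r * x) = r • MonoidAlgebra.linearExtend k g x +
      MonoidAlgebra.lift k k S χ x • MonoidAlgebra.linearExtend k g r := by
  induction r using MonoidAlgebra.induction_on with
  | add r r' hr hr' => simp only [add_mul, map_add, add_smul, smul_add, hr, hr']; abel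
  | smul c r hr =>
    simp only [smul_mul_assoc, map_smul, hr, smul_add, smul_assoc]
    rw [smul_comm c (MonoidAlgebra.lift k k S χ x)]
  | of s =>
    induction x using MonoidAlgebra.induction_on with
    | add x x' hx hx' => simp only [mul_add, map_add, add_smul, smul_add, hx, hx']; abel
    | smul c x hx =>
      simp only [mul_smul_comm, map_smul, hx, smul_add, smul_assoc]
      rw [smul_comm c (MonoidAlgebra.of k S s)]
    | of t =>
      rw [← map_mul, MonoidAlgebra.linearExtend_of, crossedHom.apply_mul hg,
        MonoidAlgebra.linearExtend_of, MonoidAlgebra.linearExtend_of, MonoidAlgebra.lift_of]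

theorem smul_eq_lift_smul {m : N} (hm : ∀ s, MonoidAlgebra.of k S s • m = χ s • m)
    (r : MonoidAlgebra k S) : r • m = MonoidAlgebra.lift k k S χ r • m := by
  induction r using MonoidAlgebra.induction_on with
  | of s => rw [hm, MonoidAlgebra.lift_of]
  | add r r' hr hr' => rw [add_smul, map_add, add_smul, hr, hr']
  | smul c r hr => rw [smul_assoc, hr, map_smul, smul_assoc]

end CrossedHom

open CategoryTheory in
open scoped ModuleCat in
/-- If `M` is one-dimensional with character `χ`, then `Ext¹(M, N)` is the space of crossed
homomorphisms modulo the principal ones. -/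
theorem exists_linearMap_crossedHom_ext {k : Type u} {S : Type v} [Field k] [Monoid S]
    (χ : S →* k) (M N : ModuleCat.{max u v} (MonoidAlgebra k S)) (m : M) (hm : m ≠ 0)
    (hgen : Function.Surjective (LinearMap.toSpanSingleton (MonoidAlgebra k S) M m))
    (hχ : ∀ s, MonoidAlgebra.of k S s • m = χ s • m) :
    ∃ Φ : crossedHom χ N →ₗ[k] Abelian.Ext.{max u v} M N 1,
      Function.Surjective Φ ∧
      ∀ g, Φ g = 0 ↔ ∃ n : N, ∀ s, g.1 s = MonoidAlgebra.of k S s • n - χ s • n := by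
  obtain ⟨Ψ, hsurj, hker⟩ := exists_linearMap_annihilator_ext k M N m hgen
  have hmem (x : MonoidAlgebra k S) : x ∈ (LinearMap.toSpanSingleton (MonoidAlgebra k S) M m).ker ↔
      MonoidAlgebra.lift k k S χ x = 0 := by
    simp [smul_eq_lift_smul hχ, hm]
  let ρ : crossedHom χ N →ₗ[k]
      (ModuleCat.of (MonoidAlgebra k S)
        (LinearMap.toSpanSingleton (MonoidAlgebra k S) M m).ker ⟶ N) :=
    { toFun g := ModuleCat.ofHom
        { toFun x := MonoidAlgebra.linearExtend k g.1 x.1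
          map_add' x y := by simp
          map_smul' r x := by
            have := (hmem x.1).1 x.2
            simp [crossedHom.linearExtend_mul g.2, this] }
      map_add' f g := by ext; simp
      map_smul' c g := by ext; simp }
  have hρ (g : crossedHom χ N) (x) : (ρ g).hom x = MonoidAlgebra.linearExtend k g.1 x.1 := rfl
  have hsub (s : S) : MonoidAlgebra.of k S s - χ s • 1 ∈
      (LinearMap.toSpanSingleton (MonoidAlgebra k S) M m).ker := by
    rw [hmem, map_sub, map_smul, map_one, MonoidAlgebra.lift_of]
    simp
  have hg1 (g : crossedHom χ N) : g.1 1 = 0 := by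
    have := crossedHom.apply_mul g.2 1 1
    rwa [map_one, map_one, one_smul, one_smul, mul_one, left_eq_add] at this
  refine ⟨Ψ.comp ρ, ?_, fun g => ?_⟩
  · intro x
    obtain ⟨f, rfl⟩ := hsurj x
    have hf (c : k) (x : (LinearMap.toSpanSingleton (MonoidAlgebra k S) M m).ker) :
        c • f.hom x = f.hom (algebraMap k (MonoidAlgebra k S) c • x) := by
      rw [map_smul, algebraMap_smul]
    -- The crossed identity for `g` comes from `st - χ(st) = s(t - χ(t)) + χ(t)(s - χ(s))`.
    let g (s : S) : N := f.hom ⟨_, hsub s⟩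
    have hg : g ∈ crossedHom χ N := by
      intro s t
      simp only [g]
      rw [hf, ← map_smul, ← map_add]
      congr 1
      ext1
      simp only [Submodule.coe_add, Submodule.coe_smul, smul_eq_mul, ← Algebra.smul_def, mul_sub,
        map_mul, mul_smul, mul_smul_comm, mul_one]
      rw [Algebra.algebraMap_eq_smul_one, smul_comm (χ s)]
      abel
    have hfg (r : MonoidAlgebra k S) : ∀ h, MonoidAlgebra.linearExtend k g r =
        f.hom ⟨r - MonoidAlgebra.lift k k S χ r • 1, h⟩ := by
      have hr (r : MonoidAlgebra k S) : r - MonoidAlgebra.lift k k S χ r • 1 ∈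
          (LinearMap.toSpanSingleton (MonoidAlgebra k S) M m).ker := by
        rw [hmem, map_sub, map_smul, map_one, smul_eq_mul, mul_one, sub_self]
      induction r using MonoidAlgebra.induction_on with
      | of s =>
        intro h
        simp only [MonoidAlgebra.linearExtend_of, g, MonoidAlgebra.lift_of]
      | add x y hx hy =>
        intro h
        rw [map_add, hx (hr x), hy (hr y), ← map_add]
        congr 1
        ext1
        simp only [Submodule.coe_add, map_add, add_smul]
        abel
      | smul c x hx =>
        intro h
        rw [map_smul, hx (hr x), hf]
        congr 1
        ext1
        simp only [Submodule.coe_smul, smul_eq_mul, ← Algebra.smul_def, map_smul, smul_sub,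
          mul_smul]
    refine ⟨⟨g, hg⟩, ?_⟩
    rw [LinearMap.comp_apply]
    congr 1
    ext x
    have hx := (hmem x.1).1 x.2
    rw [hρ, hfg x.1 (by simp [hx])]
    congr 1
    ext1
    simp [hx]
  · rw [LinearMap.comp_apply, hker]
    refine exists_congr fun n => ⟨fun h s => ?_, fun h x => ?_⟩
    · have h1 : MonoidAlgebra.linearExtend k g.1 1 = 0 := by
        rw [← map_one (MonoidAlgebra.of k S), MonoidAlgebra.linearExtend_of, hg1]
      have := h ⟨_, hsub s⟩
      rw [hρ, map_sub, map_smul, MonoidAlgebra.linearExtend_of, h1, smul_zero, sub_zero] at this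
      rw [this, sub_smul, smul_assoc, one_smul]
    · have hr (r : MonoidAlgebra k S) : MonoidAlgebra.linearExtend k g.1 r =
          r • n - MonoidAlgebra.lift k k S χ r • n := by
        induction r using MonoidAlgebra.induction_on with
        | of s => rw [MonoidAlgebra.linearExtend_of, h, MonoidAlgebra.lift_of]
        | add x y hx hy => rw [map_add, hx, hy, map_add, add_smul, add_smul]; abel
        | smul c x hx => rw [map_smul, hx, map_smul, smul_sub, smul_assoc, smul_assoc]
      rw [hρ, hr, (hmem x.1).1 x.2, zero_smul, sub_zero]

/-! ### Simple modules and characters -/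

section SimpleModules

variable {k S M : Type*} [Field k] [Monoid S] [AddCommGroup M] [Module (MonoidAlgebra k S) M]

theorem finrank_eq_one_of_forall_of_smul [Module k M] [IsScalarTower k (MonoidAlgebra k S) M]
    [IsSimpleModule (MonoidAlgebra k S) M] (χ : S →* k)
    (hχ : ∀ s (m : M), MonoidAlgebra.of k S s • m = χ s • m) : Module.finrank k M = 1 := by
  have := IsSimpleModule.nontrivial (MonoidAlgebra k S) M
  obtain ⟨m, hm⟩ := exists_ne (0 : M)
  rw [finrank_eq_one_iff_of_nonzero' m hm]
  intro x
  obtain ⟨r, rfl⟩ := IsSimpleModule.toSpanSingleton_surjective (MonoidAlgebra k S) hm x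
  exact ⟨_, (smul_eq_lift_smul (fun s => hχ s m) r).symm⟩

end SimpleModules

namespace FreeLRB

variable {A : Type*} [DecidableEq A]

theorem val_mul (s t : FreeLRB A) : (s * t).1 = s.1 ++ t.1.filter (fun a => a ∉ s.1) := rfl

@[simp]
theorem supp_one : (1 : FreeLRB A).supp = ∅ := rfl

@[simp]
theorem mem_supp {s : FreeLRB A} {a : A} : a ∈ s.supp ↔ a ∈ s.1 := List.mem_toFinset

@[simp]
theorem supp_mul (s t : FreeLRB A) : (s * t).supp = s.supp ∪ t.supp := by
  ext a
  simp only [mem_supp, val_mul, Finset.mem_union, List.mem_append, List.mem_filter,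
    decide_eq_true_eq]
  tauto

/-- Every letter of `t` is deleted. This contains both band laws, `s * s = s` and `s * t * s = s *
t`. -/
theorem mul_eq_left {s t : FreeLRB A} (h : t.supp ⊆ s.supp) : s * t = s := by
  apply Subtype.ext
  rw [val_mul, List.append_right_eq_self, List.filter_eq_nil_iff]
  intro a ha
  simpa using mem_supp.1 (h (mem_supp.2 ha))

theorem exists_supp_eq (X : Finset A) : ∃ s : FreeLRB A, s.supp = X :=
  ⟨⟨X.toList, X.nodup_toList⟩, X.toList_toFinset⟩

instance [Finite A] : Finite (FreeLRB A) := by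
  have := Fintype.ofFinite A
  exact inferInstanceAs (Finite {l : List A // l.Nodup})

/-- The word with the single letter `a`. -/
def letter (a : A) : FreeLRB A := ⟨[a], List.nodup_singleton a⟩

@[simp]
theorem supp_letter (a : A) : (letter a).supp = {a} := rfl

/-- Letters generate the monoid, so a crossed homomorphism is determined by its values on them. -/
theorem induction_letter_mul {p : FreeLRB A → Prop} (one : p 1)
    (letter_mul : ∀ a s, p s → p (letter a * s)) (s : FreeLRB A) : p s := by
  obtain ⟨l, hl⟩ := s
  induction l with
  | nil => exact one
  | cons a l ih =>
    have hal := List.nodup_cons.1 hl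
    have h : letter a * ⟨l, hal.2⟩ = (⟨a :: l, hl⟩ : FreeLRB A) := by
      have h' : l.filter (fun b => b ∉ [a]) = l := by
        refine List.filter_eq_self.2 fun b hb => ?_
        simp only [List.mem_singleton, decide_eq_true_eq]
        rintro rfl
        exact hal.1 hb
      exact Subtype.ext (congrArg (List.cons a) h')
    exact h ▸ letter_mul a _ (ih hal.2)

/-- The multiplicative character of the free left regular band attached to a set of letters. -/
def char (k : Type*) [Field k] (X : Finset A) : FreeLRB A →* k where
  toFun s := if s.supp ⊆ X then 1 else 0
  map_one' := by simp
  map_mul' s t := by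
    by_cases hs : s.supp ⊆ X <;> by_cases ht : t.supp ⊆ X <;> simp [Finset.union_subset_iff, hs, ht]

theorem char_apply (k : Type*) [Field k] (X : Finset A) (s : FreeLRB A) :
    char k X s = if s.supp ⊆ X then 1 else 0 := rfl

theorem char_smul {k M : Type*} [Field k] [AddCommGroup M] [Module k M] (X : Finset A)
    (s : FreeLRB A) (m : M) : char k X s • m = if s.supp ⊆ X then m else 0 := by
  rw [char_apply, ite_smul, one_smul, zero_smul]

/-- The free left regular band acts on a simple module through one of the characters `char k X`. -/
theorem exists_char_of_isSimpleModule (k : Type*) [Field k] [Finite A] (M : Type*) [AddCommGroup M]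
    [Module k M] [Module (MonoidAlgebra k (FreeLRB A)) M]
    [IsScalarTower k (MonoidAlgebra k (FreeLRB A)) M]
    [IsSimpleModule (MonoidAlgebra k (FreeLRB A)) M] :
    ∃ X : Finset A, ∀ (s : FreeLRB A) (m : M),
      MonoidAlgebra.of k (FreeLRB A) s • m = char k X s • m := by
  have := IsSimpleModule.nontrivial (MonoidAlgebra k (FreeLRB A)) M
  have hne : ∃ s : FreeLRB A, ∃ m : M, MonoidAlgebra.of k (FreeLRB A) s • m ≠ 0 := by
    obtain ⟨m, hm⟩ := exists_ne (0 : M)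
    exact ⟨1, m, by rwa [map_one, one_smul]⟩
  have : Nonempty {s : FreeLRB A // ∃ m : M, MonoidAlgebra.of k (FreeLRB A) s • m ≠ 0} :=
    hne.elim fun s hs => ⟨⟨s, hs⟩⟩
  obtain ⟨⟨s, m₀, hs⟩, hmax⟩ := Finite.exists_max
    fun s : {s : FreeLRB A // ∃ m : M, MonoidAlgebra.of k (FreeLRB A) s • m ≠ 0} => s.1.supp.card
  have hle (t : FreeLRB A) (ht : t.supp ⊆ s.supp) (m : M) : MonoidAlgebra.of k (FreeLRB A) s •
      MonoidAlgebra.of k (FreeLRB A) t • m = MonoidAlgebra.of k (FreeLRB A) s • m := by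
    rw [smul_smul, ← map_mul, mul_eq_left ht]
  have hnle (t : FreeLRB A) (ht : ¬ t.supp ⊆ s.supp) (m : M) : MonoidAlgebra.of k (FreeLRB A) s •
      MonoidAlgebra.of k (FreeLRB A) t • m = 0 := by
    by_contra h
    rw [smul_smul, ← map_mul] at h
    have := hmax ⟨s * t, m, h⟩
    rw [supp_mul] at this
    have h2 := Finset.eq_of_subset_of_card_le Finset.subset_union_left this
    exact ht (h2 ▸ Finset.subset_union_right)
  -- The kernel of `s` is stable because `s * t` acts either as `s` or as zero.
  let K : Submodule (MonoidAlgebra k (FreeLRB A)) M :=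
    { carrier := {m | MonoidAlgebra.of k (FreeLRB A) s • m = 0}
      add_mem' {x y} hx hy := by
        rw [Set.mem_ofPred_eq] at *
        rw [smul_add, hx, hy, add_zero]
      zero_mem' := smul_zero _
      smul_mem' r x hx := by
        rw [Set.mem_ofPred_eq] at *
        induction r using MonoidAlgebra.induction_on with
        | of t =>
          by_cases ht : t.supp ⊆ s.supp
          · rw [hle t ht, hx]
          · exact hnle t ht x
        | add r r' hr hr' => rw [add_smul, smul_add, hr, hr', add_zero]
        | smul c r hr => rw [smul_assoc, smul_comm, hr, smul_zero] }
  have hK : K = ⊥ := (eq_bot_or_eq_top K).resolve_right fun h =>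
    hs ((h ▸ Submodule.mem_top : m₀ ∈ K) :)
  have hinj {x : M} (hx : MonoidAlgebra.of k (FreeLRB A) s • x = 0) : x = 0 := by
    rw [← Submodule.mem_bot (MonoidAlgebra k (FreeLRB A)), ← hK]
    exact hx
  refine ⟨s.supp, fun t m => ?_⟩
  rw [char_smul]
  split_ifs with ht
  · rw [← sub_eq_zero]
    exact hinj (by rw [smul_sub, hle t ht, sub_self])
  · exact hinj (hnle t ht m)

end FreeLRB

/-! ### Crossed homomorphisms on the free left regular band -/

namespace FreeLRB

section CrossedHom

variable {k A N : Type*} [Field k] [DecidableEq A] [AddCommGroup N] [Module k N]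
  [Module (MonoidAlgebra k (FreeLRB A)) N] [IsScalarTower k (MonoidAlgebra k (FreeLRB A)) N]
  {X Y : Finset A}

theorem crossedHom_apply_mul
    (hN : ∀ (s : FreeLRB A) (n : N), MonoidAlgebra.of k (FreeLRB A) s • n = char k Y s • n)
    {g : FreeLRB A → N} (hg : g ∈ crossedHom (char k X) N) (s t : FreeLRB A) :
    g (s * t) = (if s.supp ⊆ Y then g t else 0) + if t.supp ⊆ X then g s else 0 := by
  rw [crossedHom.apply_mul hg, hN, char_smul, char_smul]

/-- All crossed homomorphisms are principal unless `Y ⊂ X`. -/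
theorem crossedHom_principal
    (hN : ∀ (s : FreeLRB A) (n : N), MonoidAlgebra.of k (FreeLRB A) s • n = char k Y s • n)
    (hXY : ¬ Y ⊂ X) {g : FreeLRB A → N} (hg : g ∈ crossedHom (char k X) N) :
    ∃ n : N, ∀ s, g s = MonoidAlgebra.of k (FreeLRB A) s • n - char k X s • n := by
  have hmul := crossedHom_apply_mul hN hg
  by_cases h : Y ⊆ X
  · obtain rfl : Y = X := (eq_or_ssubset_of_subset h).resolve_right hXY
    refine ⟨0, fun s => ?_⟩
    -- By idempotence, `g s` equals `2 • g s` or `0`, so `g` vanishes.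
    have := hmul s s
    rw [mul_eq_left subset_rfl] at this
    rw [smul_zero, smul_zero, sub_zero]
    split_ifs at this
    · rwa [left_eq_add] at this
    · rwa [add_zero] at this
  · obtain ⟨y, hyY, hyX⟩ := Finset.not_subset.1 h
    refine ⟨g (letter y), fun s => ?_⟩
    -- Expanding `g` on both sides, with `y ∈ Y \ X`, expresses `g s` through `g (letter y)`.
    have h1 : letter y * s * letter y = letter y * s := mul_eq_left (by simp)
    have h2 := hmul (letter y * s) (letter y)
    rw [h1, hmul (letter y) s] at h2
    simp only [supp_mul, supp_letter, Finset.union_subset_iff, Finset.singleton_subset_iff, hyY,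
      hyX, true_and, if_true, if_false, add_zero] at h2
    rw [hN, char_smul, char_smul]
    exact eq_sub_of_add_eq h2

/-- The values of a crossed homomorphism at the letters in `X \ Y`. -/
def crossedHomEval (k N : Type*) {A : Type*} [Field k] [DecidableEq A] [AddCommGroup N] [Module k N]
    [Module (MonoidAlgebra k (FreeLRB A)) N] [IsScalarTower k (MonoidAlgebra k (FreeLRB A)) N]
    (X Y : Finset A) : crossedHom (char k X) N →ₗ[k] ((X \ Y : Finset A) → N) where
  toFun g a := g.1 (letter a)
  map_add' _ _ := rfl
  map_smul' _ _ := rfl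

/-- Idempotence of a letter `a` forces `g (letter a) = 0` when `a ∉ X \ Y`; the remaining letters
are those evaluated. -/
theorem crossedHomEval_injective
    (hN : ∀ (s : FreeLRB A) (n : N), MonoidAlgebra.of k (FreeLRB A) s • n = char k Y s • n)
    (hXY : Y ⊆ X) : Function.Injective (crossedHomEval k N X Y) := by
  rw [← LinearMap.ker_eq_bot, LinearMap.ker_eq_bot']
  rintro ⟨g, hg⟩ hg0
  have hmul := crossedHom_apply_mul hN hg
  have hl (a : A) : g (letter a) = 0 := by
    by_cases ha : a ∈ X \ Y
    · exact congrFun hg0 ⟨a, ha⟩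
    have := hmul (letter a) (letter a)
    rw [mul_eq_left subset_rfl] at this
    simp only [supp_letter, Finset.singleton_subset_iff] at this
    by_cases haY : a ∈ Y
    · rwa [if_pos haY, if_pos (hXY haY), left_eq_add] at this
    · have haX : a ∉ X := fun h => ha (Finset.mem_sdiff.2 ⟨h, haY⟩)
      rwa [if_neg haY, if_neg haX, add_zero] at this
  ext s
  change g s = 0
  induction s using induction_letter_mul with
  | one =>
    have := hmul 1 1
    rwa [mul_one, supp_one, if_pos (Finset.empty_subset _), if_pos (Finset.empty_subset _),
      left_eq_add] at this
  | letter_mul a s hs => rw [hmul, hs, hl, ite_self, ite_self, add_zero]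

theorem crossedHomEval_surjective
    (hN : ∀ (s : FreeLRB A) (n : N), MonoidAlgebra.of k (FreeLRB A) s • n = char k Y s • n)
    (hXY : Y ⊆ X) : Function.Surjective (crossedHomEval k N X Y) := by
  intro c
  let c' (a : A) : N := if h : a ∈ X \ Y then c ⟨a, h⟩ else 0
  -- On words in `X`, prescribe the value by the first letter outside `Y`. If `s` lies in `Y`,
  -- multiplying by `s` on the left deletes only letters of `Y`, so that first letter is unchanged.
  let g (s : FreeLRB A) : N :=
    if s.supp ⊆ X then (s.1.find? (fun a => a ∉ Y)).elim 0 c' else 0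
  have hnone {s : FreeLRB A} : s.1.find? (fun a => a ∉ Y) = none ↔ s.supp ⊆ Y := by
    simp [List.find?_eq_none, Finset.subset_iff]
  have hg : g ∈ crossedHom (char k X) N := by
    intro s t
    rw [hN, char_smul, char_smul]
    simp only [g, supp_mul, Finset.union_subset_iff]
    by_cases hsX : s.supp ⊆ X
    · by_cases htX : t.supp ⊆ X
      · by_cases hsY : s.supp ⊆ Y
        · have : (t.1.filter (fun a => a ∉ s.1)).find? (fun a => a ∉ Y) =
              t.1.find? (fun a => a ∉ Y) := by
            rw [List.find?_filter]
            congr 1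
            ext a
            have : a ∈ s.1 → a ∈ Y := fun h => hsY (mem_supp.2 h)
            simp only [decide_eq_true_eq, Bool.decide_and]
            by_cases ha : a ∈ Y <;> simp [ha]
            exact fun h => ha (this h)
          rw [val_mul, List.find?_append, hnone.2 hsY, this]
          simp [hsX, htX, hsY]
        · obtain ⟨a, ha⟩ := Option.ne_none_iff_exists'.1 (fun h => hsY (hnone.1 h))
          rw [val_mul, List.find?_append, ha]
          simp [hsX, htX, hsY]
      · simp [htX]
    · have hsY : ¬ s.supp ⊆ Y := fun h => hsX (h.trans hXY)
      simp [hsX, hsY]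
  refine ⟨⟨g, hg⟩, ?_⟩
  ext ⟨a, ha⟩
  obtain ⟨haX, haY⟩ := Finset.mem_sdiff.1 ha
  simp [crossedHomEval, g, letter, c', haX, haY, supp]

end CrossedHom

/-! ### Dimension of Ext¹ between simple modules -/

section Ext

open CategoryTheory
open scoped ModuleCat

variable {k : Type u} {A : Type v} [Field k] [DecidableEq A]
  (M N : ModuleCat.{max u v} (MonoidAlgebra k (FreeLRB A)))
  [IsSimpleModule (MonoidAlgebra k (FreeLRB A)) M] {X Y : Finset A}

theorem subsingleton_ext
    (hM : ∀ (s : FreeLRB A) (m : M), MonoidAlgebra.of k (FreeLRB A) s • m = char k X s • m)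
    (hN : ∀ (s : FreeLRB A) (n : N), MonoidAlgebra.of k (FreeLRB A) s • n = char k Y s • n)
    (hXY : ¬ Y ⊂ X) : Subsingleton (Abelian.Ext.{max u v} M N 1) := by
  have := IsSimpleModule.nontrivial (MonoidAlgebra k (FreeLRB A)) M
  obtain ⟨m, hm⟩ := exists_ne (0 : M)
  obtain ⟨Φ, hsurj, hker⟩ := exists_linearMap_crossedHom_ext (char k X) M N m hm
    (IsSimpleModule.toSpanSingleton_surjective _ hm) (fun s => hM s m)
  refine subsingleton_of_forall_eq 0 fun x => ?_
  obtain ⟨g, rfl⟩ := hsurj x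
  exact (hker g).2 (crossedHom_principal hN hXY g.2)

theorem finrank_ext [IsSimpleModule (MonoidAlgebra k (FreeLRB A)) N]
    (hM : ∀ (s : FreeLRB A) (m : M), MonoidAlgebra.of k (FreeLRB A) s • m = char k X s • m)
    (hN : ∀ (s : FreeLRB A) (n : N), MonoidAlgebra.of k (FreeLRB A) s • n = char k Y s • n)
    (hXY : Y ⊂ X) : Module.Finite k (Abelian.Ext.{max u v} M N 1) ∧
      Module.finrank k (Abelian.Ext.{max u v} M N 1) = (X \ Y).card - 1 := by
  have := IsSimpleModule.nontrivial (MonoidAlgebra k (FreeLRB A)) M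
  obtain ⟨m, hm⟩ := exists_ne (0 : M)
  obtain ⟨Φ, hsurj, hker⟩ := exists_linearMap_crossedHom_ext (char k X) M N m hm
    (IsSimpleModule.toSpanSingleton_surjective _ hm) (fun s => hM s m)
  have hN1 : Module.finrank k N = 1 := finrank_eq_one_of_forall_of_smul (char k Y) hN
  have : Module.Finite k N := Module.finite_of_finrank_eq_succ hN1
  let e := LinearEquiv.ofBijective (crossedHomEval k N X Y)
    ⟨crossedHomEval_injective hN hXY.subset, crossedHomEval_surjective hN hXY.subset⟩
  have : Module.Finite k (crossedHom (char k X) N) := Module.Finite.equiv e.symm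
  have hcard : Module.finrank k (crossedHom (char k X) N) = (X \ Y).card := by
    rw [e.finrank_eq, Module.finrank_pi_fintype]
    simp [hN1]
  obtain ⟨a, haX, haY⟩ := Finset.exists_of_ssubset hXY
  have hker1 : Module.finrank k Φ.ker = 1 := by
    -- For `a ∈ X \ Y`, the principal map of `n` takes the value `0 - n` at `letter a`, so `n` is
    -- recovered and `Φ.ker` is a copy of `N`.
    let j : Φ.ker →ₗ[k] N :=
      { toFun g := g.1.1 (letter a)
        map_add' _ _ := rfl
        map_smul' _ _ := rfl }
    have hj (g : Φ.ker) {n : N} (hn : ∀ s, g.1.1 s =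
        MonoidAlgebra.of k (FreeLRB A) s • n - char k X s • n) : j g = -n := by
      change g.1.1 (letter a) = -n
      rw [hn, hN, char_smul, char_smul]
      simp [haX, haY]
    refine (LinearEquiv.ofBijective j ⟨?_, ?_⟩).finrank_eq.trans hN1
    · intro g g' h
      obtain ⟨n, hn⟩ := (hker g.1).1 g.2
      obtain ⟨n', hn'⟩ := (hker g'.1).1 g'.2
      rw [hj g hn, hj g' hn', neg_inj] at h
      ext s
      rw [hn, hn', h]
    · intro n
      have hmem : (fun s => MonoidAlgebra.of k (FreeLRB A) s • (-n) - char k X s • (-n)) ∈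
          crossedHom (char k X) N := by
        intro s t
        simp only [map_mul, mul_smul, smul_sub]
        rw [smul_comm (char k X t) (MonoidAlgebra.of k (FreeLRB A) s),
          smul_comm (char k X t) (char k X s)]
        abel
      have h0 := (hker ⟨_, hmem⟩).2 ⟨-n, fun s => rfl⟩
      exact ⟨⟨⟨_, hmem⟩, h0⟩, (hj ⟨⟨_, hmem⟩, h0⟩ (n := -n) fun s => rfl).trans (neg_neg n)⟩
  refine ⟨Module.Finite.of_surjective Φ hsurj, ?_⟩
  have := Φ.finrank_range_add_finrank_ker
  rw [LinearMap.range_eq_top.2 hsurj, finrank_top, hker1, hcard] at this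
  omega

end Ext

/-! ### The simple module of each subset -/

section Vertices

variable (k : Type u) {A : Type v} [Field k] [DecidableEq A]

/-- The kernel of the extension of `char k X` to the algebra. -/
noncomputable def charIdeal (X : Finset A) : Ideal (MonoidAlgebra k (FreeLRB A)) :=
  RingHom.ker (MonoidAlgebra.lift k k (FreeLRB A) (char k X))

instance (X : Finset A) : (charIdeal k X).IsMaximal :=
  RingHom.ker_isMaximal_of_surjective _ fun c =>
    ⟨algebraMap _ _ c, by rw [AlgHom.commutes, Algebra.algebraMap_self_apply]⟩

instance (X : Finset A) :
    IsSimpleModule (MonoidAlgebra k (FreeLRB A)) (MonoidAlgebra k (FreeLRB A) ⧸ charIdeal k X) :=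
  isSimpleModule_iff_isCoatom.2 (Ideal.IsMaximal.out)

theorem of_smul_quotient_charIdeal (X : Finset A) (s : FreeLRB A)
    (m : MonoidAlgebra k (FreeLRB A) ⧸ charIdeal k X) :
    MonoidAlgebra.of k (FreeLRB A) s • m = if s.supp ⊆ X then m else 0 := by
  obtain ⟨r, rfl⟩ := Submodule.Quotient.mk_surjective _ m
  rw [← char_smul (k := k), ← Submodule.Quotient.mk_smul, ← Submodule.Quotient.mk_smul,
    Submodule.Quotient.eq, charIdeal, RingHom.mem_ker, map_sub, smul_eq_mul, map_mul, map_smul,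
    MonoidAlgebra.lift_of, smul_eq_mul, sub_self]

/-- A simple module with character `char k X` is isomorphic to the quotient by `charIdeal k X`. -/
theorem nonempty_linearEquiv_quotient_charIdeal {X : Finset A} (M : Type*) [AddCommGroup M]
    [Module k M] [Module (MonoidAlgebra k (FreeLRB A)) M]
    [IsScalarTower k (MonoidAlgebra k (FreeLRB A)) M]
    [IsSimpleModule (MonoidAlgebra k (FreeLRB A)) M]
    (hM : ∀ (s : FreeLRB A) (m : M), MonoidAlgebra.of k (FreeLRB A) s • m = char k X s • m) :
    Nonempty ((MonoidAlgebra k (FreeLRB A) ⧸ charIdeal k X) ≃ₗ[MonoidAlgebra k (FreeLRB A)] M) := by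
  have := IsSimpleModule.nontrivial (MonoidAlgebra k (FreeLRB A)) M
  obtain ⟨m, hm⟩ := exists_ne (0 : M)
  have hker : charIdeal k X =
      (LinearMap.toSpanSingleton (MonoidAlgebra k (FreeLRB A)) M m).ker := by
    ext r
    rw [charIdeal, RingHom.mem_ker, LinearMap.mem_ker, LinearMap.toSpanSingleton_apply,
      smul_eq_lift_smul (fun s => hM s m), smul_eq_zero_iff_left hm]
  exact ⟨(Submodule.quotEquivOfEq _ _ hker).trans
    (LinearMap.quotKerEquivOfSurjective _ (IsSimpleModule.toSpanSingleton_surjective _ hm))⟩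

end Vertices

end FreeLRB

/-! ### The quiver -/

open FreeLRB
open scoped ModuleCat in
theorem mainTheorem4 (k : Type u) [Field k] (A : Type v) [Finite A] [DecidableEq A] :
    -- the algebra is finite-dimensional with only one-dimensional simple modules
    Module.Finite k (MonoidAlgebra k (FreeLRB A)) ∧
    (∀ (M : Type w) [AddCommGroup M] [Module k M] [Module (MonoidAlgebra k (FreeLRB A)) M]
      [IsScalarTower k (MonoidAlgebra k (FreeLRB A)) M]
      [IsSimpleModule (MonoidAlgebra k (FreeLRB A)) M], Module.finrank k M = 1) ∧
    ∃ e : Finset A ≃ ExtQuiver k (MonoidAlgebra k (FreeLRB A)),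
      -- the vertex of `X` is the class of the simple module on which `s` acts as `χ_X(s)`
      (∀ (X : Finset A) (M : ModuleCat.{max u v} (MonoidAlgebra k (FreeLRB A)))
        (hM : IsSimpleModule (MonoidAlgebra k (FreeLRB A)) M),
        ExtQuiver.mk k M hM = e X ↔
          ∀ (s : FreeLRB A) (m : M),
            MonoidAlgebra.of k (FreeLRB A) s • m = if s.supp ⊆ X then m else 0) ∧
      -- the arrows
      (∀ X Y : Finset A, Y ⊂ X → Nonempty ((e X ⟶ e Y) ≃ Fin ((X \ Y).card - 1))) ∧
      (∀ X Y : Finset A, ¬ Y ⊂ X → IsEmpty (e X ⟶ e Y)) := by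
  refine ⟨?_, ?_, ?_⟩
  · exact Module.Finite.equiv (MonoidAlgebra.coeffLinearEquiv k).symm
  · intro M _ _ _ _ _
    obtain ⟨X, hX⟩ := exists_char_of_isSimpleModule k M (A := A)
    exact finrank_eq_one_of_forall_of_smul (char k X) hX
  let f (X : Finset A) : ExtQuiver k (MonoidAlgebra k (FreeLRB A)) :=
    ExtQuiver.mk k (ModuleCat.of _ (MonoidAlgebra k (FreeLRB A) ⧸ charIdeal k X))
      (inferInstanceAs (IsSimpleModule _ (MonoidAlgebra k (FreeLRB A) ⧸ charIdeal k X)))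
  have hf (X : Finset A) (M : ModuleCat.{max u v} (MonoidAlgebra k (FreeLRB A)))
      (hM : IsSimpleModule (MonoidAlgebra k (FreeLRB A)) M) : ExtQuiver.mk k M hM = f X ↔
        ∀ (s : FreeLRB A) (m : M),
          MonoidAlgebra.of k (FreeLRB A) s • m = if s.supp ⊆ X then m else 0 := by
    constructor
    · intro h s m
      obtain ⟨i⟩ := Quotient.exact h
      let e := i.toLinearEquiv
      apply e.injective
      rw [map_smul]
      refine (of_smul_quotient_charIdeal k X s (e m)).trans ?_
      split_ifs <;> simp
    · intro h
      obtain ⟨e⟩ := nonempty_linearEquiv_quotient_charIdeal k M (X := X)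
        fun s m => by rw [h, char_smul]
      exact Quotient.sound ⟨e.symm.toModuleIso⟩
  have hbij : Function.Bijective f := by
    -- A word with support exactly `X` acts as `1` on the simple module of `X`, but as `0` on that
    -- of `Y` if `X ⊄ Y`.
    have hle {X Y : Finset A} (h : f X = f Y) : X ⊆ Y := by
      have h' := (hf Y _ _).1 h
      obtain ⟨s, rfl⟩ := exists_supp_eq X
      have := IsSimpleModule.nontrivial (MonoidAlgebra k (FreeLRB A))
        (MonoidAlgebra k (FreeLRB A) ⧸ charIdeal k s.supp)
      obtain ⟨m, hm⟩ := exists_ne (0 : MonoidAlgebra k (FreeLRB A) ⧸ charIdeal k s.supp)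
      by_contra hs
      have h1 := of_smul_quotient_charIdeal k s.supp s m
      have h2 := h' s m
      rw [if_neg hs] at h2
      rw [if_pos subset_rfl] at h1
      exact hm (h1.symm.trans h2)
    refine ⟨fun X Y h => (hle h).antisymm (hle h.symm), fun x => ?_⟩
    induction x using Quotient.inductionOn with
    | h M =>
      obtain ⟨M, hM⟩ := M
      obtain ⟨X, hX⟩ := exists_char_of_isSimpleModule k M (A := A)
      refine ⟨X, ((hf X M hM).2 fun s m => ?_).symm⟩
      rw [hX, char_smul]
  let e := Equiv.ofBijective f hbij
  have hsimple (x : ExtQuiver k (MonoidAlgebra k (FreeLRB A))) :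
      IsSimpleModule (MonoidAlgebra k (FreeLRB A)) x.repr := (Quotient.out x : SimpleMod _).2
  have hrepr (X : Finset A) (s : FreeLRB A) (m : (e X).repr) :
      MonoidAlgebra.of k (FreeLRB A) s • m = char k X s • m := by
    rw [char_smul]
    exact (hf X (e X).repr (hsimple _)).1 (Quotient.out_eq (e X)) s m
  refine ⟨e, hf, fun X Y hXY => ?_, fun X Y hXY => ?_⟩
  · obtain ⟨hfin, hrank⟩ := finrank_ext (e X).repr (e Y).repr (hrepr X) (hrepr Y) hXY
    exact ⟨(Module.Basis.ofVectorSpace k _).indexEquiv (Module.finBasisOfFinrankEq k _ hrank)⟩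
  · have := subsingleton_ext (e X).repr (e Y).repr (hrepr X) (hrepr Y) hXY
    exact ⟨fun i => (Module.Basis.ofVectorSpace k
      (CategoryTheory.Abelian.Ext.{max u v} (e X).repr (e Y).repr 1)).ne_zero i
        (Subsingleton.elim _ _)⟩
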